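/- Let $\alpha\ge 16$ be an even number and let $\psi:[0,\infty)\to\mathbb R$ be an $\mathbb R^+$ prime coding with coefficients $(\xi_m)_{m\ge 0}$, that is, $0<\xi_0<\xi_1<\xi_2<\cdots$ and $\psi(x)=\xi_m(x-m)+\sum_{j<m}\xi_j$ for $x\in[m,m+1]$, $m=0,1,2,\dots$ (so $\psi(0)=0$, and $\psi$ is continuous and strictly increasing). For $k\in[4,\alpha/2]$ put $$D_I(k)=\{(x,y): x\ge 2,\ y\ge x,\ xy\le k\},\qquad D_S(k)=\{(x,y): x\ge 2,\ y\ge x,\ \alpha-k\le xy\le \alpha-4\},$$ and let $\widehat A_I(\psi(k))$ and $\widehat A_S(\psi(k))$ be the areas of $(\psi\times\psi)(D_I(k))$ and $(\psi\times\psi)(D_S(k))$, regarded as functions of the variable $\hat k=\psi(k)$. For $k_0\in\{4,5,\dots,\alpha/2-1\}$ the lower and upper essential polynomials $P_{I,k_0}$ and $P_{S,k_0}$ are the real polynomials in variables $X_0,X_1,\dots$ such that, for every prime coding $\psi$ with coefficients $\xi$, the functions $\widehat A_I$ and $\widehat A_S$ are twice differentiable on $[\psi(k_0),\psi(k_0+1)]$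 (one-sidedly at the end points), with $$\widehat A_I''(\psi(k))=P_{I,k_0}(\xi)\,\frac{1}{\xi_{k_0}^2\,k},\qquad \widehat A_S''(\psi(k))=P_{S,k_0}(\xi)\,\frac{1}{\xi_{k_0}^2\,(\alpha-k)}\qquad(k\in[k_0,k_0+1]).$$ The essential points are $P_{k_0}=(x_{k_0},y_{k_0})=(P_{I,k_0}(\xi),P_{S,k_0}(\xi))$, $k_0=4,5,\dots,\alpha/2-1$. Then the essential points $P_4,\dots,P_{\alpha/2-1}$ are well defined, and for every $k_0\in\{5,6,\dots,\alpha/2-1\}$: the even number $\alpha$ is the sum of the two primes $k_0$ and $\alpha-k_0$ if and only if the consecutive essential points $P_{k_0-1}$ and $P_{k_0}$ coincide, i.e. $P_{k_0-1}=P_{k_0}$. -/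

import Mathlib

open Set MeasureTheory

namespace GoldbachEssential

/-- An `ℝ⁺` coding function: `ψ(0) = 0`, `ψ` is continuous on `[0, ∞)`, and on every interval
`[m, m+1]` it is of class `C¹` with positive derivative. Only the values of `ψ` on `[0, ∞)`
are used anywhere. -/
structure IsCodingFunction (ψ : ℝ → ℝ) : Prop where
  map_zero : ψ 0 = 0
  continuousOn : ContinuousOn ψ (Ici 0)
  contDiffOn : ∀ m : ℕ, ContDiffOn ℝ 1 ψ (Icc (m : ℝ) (m + 1))
  deriv_pos : ∀ m : ℕ, ∀ x ∈ Icc (m : ℝ) (m + 1), 0 < derivWithin ψ (Icc (m : ℝ) (m + 1)) x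

/-- `ψ` is an `ℝ⁺` prime coding with coefficients `ξ₀, ξ₁, ξ₂, …`: a coding function that is
affine with slope `ξ_m` on every `[m, m+1]`, where `0 < ξ₀ < ξ₁ < ξ₂ < ⋯`. -/
structure IsPrimeCoding (ψ : ℝ → ℝ) (ξ : ℕ → ℝ) : Prop extends IsCodingFunction ψ where
  affine : ∀ m : ℕ, ∀ x ∈ Icc (m : ℝ) (m + 1),
    ψ x = ξ m * (x - m) + ∑ j ∈ Finset.range m, ξ j
  coeff_pos : 0 < ξ 0
  coeff_strictMono : StrictMono ξ

/-- The inverse `ψ⁻¹ : ψ([0, ∞)) → [0, ∞)` of a coding function. -/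
noncomputable def inv (ψ : ℝ → ℝ) : ℝ → ℝ := Function.invFunOn ψ (Ici 0)

/-- The lower region `D_I(k)`: `x ≥ 2`, `y ≥ x`, `xy ≤ k`. -/
def lowerRegion (k : ℝ) : Set (ℝ × ℝ) := {p | 2 ≤ p.1 ∧ p.1 ≤ p.2 ∧ p.1 * p.2 ≤ k}

/-- The upper region `D_S(k)`: `x ≥ 2`, `y ≥ x`, `α - k ≤ xy ≤ α - 4`. -/
def upperRegion (α k : ℝ) : Set (ℝ × ℝ) :=
  {p | 2 ≤ p.1 ∧ p.1 ≤ p.2 ∧ α - k ≤ p.1 * p.2 ∧ p.1 * p.2 ≤ α - 4}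

/-- The lower area function, `ψ(k) ↦` area of `(ψ × ψ)(D_I(k))`, as a function of the
variable `u = ψ(k)`. -/
noncomputable def lowerArea (ψ : ℝ → ℝ) (u : ℝ) : ℝ :=
  (volume (Prod.map ψ ψ '' lowerRegion (inv ψ u))).toReal

/-- The upper area function, `ψ(k) ↦` area of `(ψ × ψ)(D_S(k))`, as a function of the
variable `u = ψ(k)`. -/
noncomputable def upperArea (ψ : ℝ → ℝ) (α : ℝ) (u : ℝ) : ℝ :=
  (volume (Prod.map ψ ψ '' upperRegion α (inv ψ u))).toReal

/-- `f` is twice differentiable on `s` (one-sidedly at end points of an interval), with second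
derivative `f''` there. -/
def HasSecondDerivOn (f f'' : ℝ → ℝ) (s : Set ℝ) : Prop :=
  ∃ f' : ℝ → ℝ, (∀ u ∈ s, HasDerivWithinAt f (f' u) s u) ∧
    ∀ u ∈ s, HasDerivWithinAt f' (f'' u) s u

/-- `p` is the lower essential polynomial of `k₀`: for every prime coding, on the interval
`ψ([k₀, k₀ + 1])` the second derivative of the lower area function at `ψ(k)` is
`p(ξ) · 1 / (ξ_{k₀}² k)`. -/
def IsLowerEssentialPolynomial (k₀ : ℕ) (p : MvPolynomial ℕ ℝ) : Prop :=
  ∀ (ψ : ℝ → ℝ) (ξ : ℕ → ℝ), IsPrimeCoding ψ ξ →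
    HasSecondDerivOn (lowerArea ψ)
      (fun u => MvPolynomial.eval ξ p * (1 / (ξ k₀ ^ 2 * inv ψ u)))
      (Icc (ψ k₀) (ψ (k₀ + 1)))

/-- `q` is the upper essential polynomial of `k₀` for the number `α`: for every prime coding, on
the interval `ψ([k₀, k₀ + 1])` the second derivative of the upper area function at `ψ(k)` is
`q(ξ) · 1 / (ξ_{k₀}² (α - k))`. -/
def IsUpperEssentialPolynomial (α k₀ : ℕ) (q : MvPolynomial ℕ ℝ) : Prop :=
  ∀ (ψ : ℝ → ℝ) (ξ : ℕ → ℝ), IsPrimeCoding ψ ξ →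
    HasSecondDerivOn (upperArea ψ α)
      (fun u => MvPolynomial.eval ξ q * (1 / (ξ k₀ ^ 2 * (α - inv ψ u))))
      (Icc (ψ k₀) (ψ (k₀ + 1)))

/-- `P` is the essential point `P_{k₀} = (x_{k₀}, y_{k₀})` for `α` and the prime coding with
coefficients `ξ`: its coordinates are the values at `ξ` of the lower and of the upper essential
polynomial of `k₀`. -/
def IsEssentialPoint (α : ℕ) (ξ : ℕ → ℝ) (k₀ : ℕ) (P : ℝ × ℝ) : Prop :=
  ∃ p q : MvPolynomial ℕ ℝ, IsLowerEssentialPolynomial k₀ p ∧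
    IsUpperEssentialPolynomial α k₀ q ∧
    P = (MvPolynomial.eval ξ p, MvPolynomial.eval ξ q)

end GoldbachEssential

namespace GoldbachEssential

/-! On `[2, N)` the slope of `ψ` at `x` is the sum of the jumps `c_j` with `2 ≤ j ≤ x`, where `c_2 =
ξ_2` and `c_j = ξ_j - ξ_{j-1}` for `j > 2`; all of them are positive. Pulled back along `ψ`,
Lebesgue measure beyond `2` is thus a positive combination of Lebesgue measures on the half-lines
`(j, ∞)`. Symmetrising `D_I(k)` about the diagonal gives the area of its image as `1/2 ∑ c_i c_j
F_{ij}(k)`, where `F_m(k) = k log(k/m) - k + m` for `k ≥ m` and `0` otherwise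
(`IsPrimeCoding.volume_image_lowerRegion`).

Since `F_m'' = 1/k` beyond `m` and `0` before it, and `ψ` is affine with slope `ξ_n` on `[n, n+1]`,
the second derivative in `ψ(k)` is `E(n) / (ξ_n² k)` with `E(n) = 1/2 ∑_{ij ≤ n} c_i c_j`. The upper
area is a constant minus the lower area at `α - k`, so its essential value at `n` is `-E(α - n -
1)`.

Finally `E(n+1) - E(n)` is half the sum of the positive numbers `c_i c_j` over factorisations `ij =
n + 1` with `i, j ≥ 2`; it vanishes exactly when `n + 1` is prime
(`IsPrimeCoding.essentialValue_eq_iff_prime`). Equality of abscissas of consecutive points tests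
`k₀`, equality of ordinates tests `α - k₀`. -/

/-- The jumps of the slope of a prime coding cut off below `2`. -/
def jump {R : Type*} [CommRing R] (x : ℕ → R) (j : ℕ) : R :=
  if j = 2 then x 2 else x j - x (j - 1)

/-! ### Elementary properties of prime codings. -/

theorem IsPrimeCoding.jump_pos {ψ : ℝ → ℝ} {ξ : ℕ → ℝ} (h : IsPrimeCoding ψ ξ) {j : ℕ}
    (hj : 2 ≤ j) : 0 < jump ξ j := by
  unfold jump
  split_ifs with h2
  · exact h.coeff_pos.trans (h.coeff_strictMono (by norm_num))
  · exact sub_pos.2 (h.coeff_strictMono (by omega))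

theorem IsPrimeCoding.slope_pos {ψ : ℝ → ℝ} {ξ : ℕ → ℝ} (h : IsPrimeCoding ψ ξ) (j : ℕ) :
    0 < ξ j :=
  h.coeff_pos.trans_le (h.coeff_strictMono.monotone (Nat.zero_le j))

theorem IsPrimeCoding.map_natCast {ψ : ℝ → ℝ} {ξ : ℕ → ℝ} (h : IsPrimeCoding ψ ξ) (m : ℕ) :
    ψ m = ∑ j ∈ Finset.range m, ξ j := by
  simpa using h.affine m m ⟨le_rfl, by linarith⟩

theorem IsPrimeCoding.strictMonoOn {ψ : ℝ → ℝ} {ξ : ℕ → ℝ} (h : IsPrimeCoding ψ ξ) :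
    StrictMonoOn ψ (Ici 0) := by
  intro x hx y hy hxy
  have hx1 := Nat.floor_le (show (0 : ℝ) ≤ x from hx)
  have hx2 := Nat.lt_floor_add_one x
  have hy1 := Nat.floor_le (show (0 : ℝ) ≤ y from hy)
  have hy2 := Nat.lt_floor_add_one y
  have ex := h.affine ⌊x⌋₊ x ⟨hx1, hx2.le⟩
  have ey := h.affine ⌊y⌋₊ y ⟨hy1, hy2.le⟩
  rcases (Nat.floor_mono hxy.le).eq_or_lt with e | e
  · rw [e] at ex
    rw [ex, ey]
    have := h.slope_pos ⌊y⌋₊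
    gcongr
  · have h1 : ∑ j ∈ Finset.range (⌊x⌋₊ + 1), ξ j ≤ ∑ j ∈ Finset.range ⌊y⌋₊, ξ j :=
      Finset.sum_le_sum_of_subset_of_nonneg (Finset.range_mono e)
        fun j _ _ => (h.slope_pos j).le
    rw [Finset.sum_range_succ] at h1
    have h2 := h.slope_pos ⌊x⌋₊
    have h3 := h.slope_pos ⌊y⌋₊
    have h4 : 0 ≤ ξ ⌊y⌋₊ * (y - ⌊y⌋₊) := mul_nonneg h3.le (by linarith)
    have h5 : ξ ⌊x⌋₊ * (x - ⌊x⌋₊) < ξ ⌊x⌋₊ * 1 := by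
      gcongr
      linarith
    linarith

theorem IsPrimeCoding.inv_map {ψ : ℝ → ℝ} {ξ : ℕ → ℝ} (h : IsPrimeCoding ψ ξ) {k : ℝ}
    (hk : 0 ≤ k) : inv ψ (ψ k) = k :=
  h.strictMonoOn.injOn.leftInvOn_invFunOn hk

/-! ### Extension of the coding to a bijection of the line. -/

/-- A piecewise affine function on the whole line that agrees with the prime coding with
coefficients `ξ` on `[2, N]`. -/
noncomputable def hinge (ξ : ℕ → ℝ) (N : ℕ) (x : ℝ) : ℝ :=
  ξ 0 + ξ 1 + ξ 2 * (x - 2) + ∑ j ∈ Finset.Ico 3 N, (ξ j - ξ (j - 1)) * max (x - j) 0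

theorem IsPrimeCoding.eq_hinge {ψ : ℝ → ℝ} {ξ : ℕ → ℝ} (h : IsPrimeCoding ψ ξ) {N : ℕ} {x : ℝ}
    (hx : x ∈ Ico (2 : ℝ) N) : ψ x = hinge ξ N x := by
  obtain ⟨h2, hN⟩ := hx
  have hx0 : 0 ≤ x := by linarith
  have hx1 := Nat.floor_le hx0
  have hx2 := Nat.lt_floor_add_one x
  have hm : 2 ≤ ⌊x⌋₊ := Nat.le_floor (by exact_mod_cast h2)
  have hmN : ⌊x⌋₊ < N := (Nat.floor_lt hx0).2 hN
  rw [h.affine ⌊x⌋₊ x ⟨hx1, hx2.le⟩, hinge]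
  -- Summation by parts: the affine formula on `[m, m+1]` rewritten through slope increments. The
  -- hinges with `j > ⌊x⌋₊` vanish at `x`.
  have key : ∀ m : ℕ, 2 ≤ m → ξ m * (x - m) + ∑ j ∈ Finset.range m, ξ j =
      ξ 0 + ξ 1 + ξ 2 * (x - 2) + ∑ j ∈ Finset.Ico 3 (m + 1), (ξ j - ξ (j - 1)) * (x - j) := by
    intro m hm
    induction m, hm using Nat.le_induction with
    | base => simp [Finset.sum_range_succ]; ring
    | succ m hm ih =>
      rw [Finset.sum_Ico_succ_top (by omega), ← add_assoc, ← ih, Finset.sum_range_succ]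
      rw [Nat.add_sub_cancel]
      push_cast
      ring
  rw [key _ hm, ← Finset.sum_Ico_consecutive _ (show 3 ≤ ⌊x⌋₊ + 1 by omega) hmN,
    Finset.sum_eq_zero (s := Finset.Ico (⌊x⌋₊ + 1) N), add_zero]
  · congr 1
    refine Finset.sum_congr rfl fun j hj => ?_
    rw [max_eq_left]
    rw [Finset.mem_Ico] at hj
    have : (j : ℝ) ≤ ⌊x⌋₊ := by exact_mod_cast (by omega : j ≤ ⌊x⌋₊)
    linarith
  · intro j hj
    rw [max_eq_right, mul_zero]
    rw [Finset.mem_Ico] at hj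
    have : (⌊x⌋₊ : ℝ) + 1 ≤ j := by exact_mod_cast hj.1
    linarith

theorem IsPrimeCoding.hinge_strictMono {ψ : ℝ → ℝ} {ξ : ℕ → ℝ} (h : IsPrimeCoding ψ ξ) (N : ℕ) :
    StrictMono (hinge ξ N) := by
  intro x y hxy
  have h2 := h.slope_pos 2
  refine add_lt_add_of_lt_of_le (by gcongr) (Finset.sum_le_sum fun j hj => ?_)
  have : 0 < ξ j - ξ (j - 1) :=
    sub_pos.2 (h.coeff_strictMono (by rw [Finset.mem_Ico] at hj; omega))
  gcongr

theorem continuous_hinge (ξ : ℕ → ℝ) (N : ℕ) : Continuous (hinge ξ N) := by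
  unfold hinge
  fun_prop

/-- The function dominates a line of slope `ξ 2 > 0` and equals it on the negative axis, so both
limits are infinite. -/
theorem IsPrimeCoding.hinge_surjective {ψ : ℝ → ℝ} {ξ : ℕ → ℝ} (h : IsPrimeCoding ψ ξ) (N : ℕ) :
    Function.Surjective (hinge ξ N) := by
  have h2 := h.slope_pos 2
  have hn : ∀ x : ℝ, 0 ≤ ∑ j ∈ Finset.Ico 3 N, (ξ j - ξ (j - 1)) * max (x - j) 0 := fun x =>
    Finset.sum_nonneg fun j hj => mul_nonneg
      (sub_pos.2 (h.coeff_strictMono (by rw [Finset.mem_Ico] at hj; omega))).le (le_max_right _ _)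
  refine (continuous_hinge ξ N).surjective ?_ ?_
  · refine Filter.tendsto_atTop_mono (f := fun x => ξ 0 + ξ 1 + ξ 2 * (x - 2))
      (fun x => le_add_of_nonneg_right (hn x)) ?_
    exact Filter.tendsto_atTop_add_const_left _ _
      ((Filter.tendsto_atTop_add_const_right _ _ Filter.tendsto_id).const_mul_atTop h2)
  · refine Filter.Tendsto.congr' (f₁ := fun x => ξ 0 + ξ 1 + ξ 2 * (x - 2)) ?_ ?_
    · filter_upwards [Filter.eventually_le_atBot 0] with x hx
      rw [hinge, Finset.sum_eq_zero, add_zero]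
      intro j _
      rw [max_eq_right, mul_zero]
      have : (0 : ℝ) ≤ j := j.cast_nonneg
      linarith
    · exact Filter.tendsto_atBot_add_const_left _ _
        ((Filter.tendsto_atBot_add_const_right _ _ Filter.tendsto_id).const_mul_atBot h2)

/-- The bijection `hinge ξ N` as an isomorphism of measurable spaces. -/
noncomputable def IsPrimeCoding.hingeEquiv {ψ : ℝ → ℝ} {ξ : ℕ → ℝ} (h : IsPrimeCoding ψ ξ)
    (N : ℕ) : ℝ ≃ᵐ ℝ :=
  ((h.hinge_strictMono N).orderIsoOfSurjective _ (h.hinge_surjective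
    N)).toHomeomorph.toMeasurableEquiv

/-! ### Pull-back of Lebesgue measure and products of such measures. -/

theorem volume_Ioc_inter_Ioi (a b c : ℝ) (hab : a < b) :
    volume (Ioc a b ∩ Ioi c) = ENNReal.ofReal (max (b - c) 0 - max (a - c) 0) := by
  have : Ioc a b ∩ Ioi c = Ioc (max a c) b := by
    ext x; simp only [mem_inter_iff, mem_Ioc, mem_Ioi, max_lt_iff]; tauto
  rw [this, Real.volume_Ioc]
  rcases le_total a c with h1 | h1 <;> rcases le_total b c with h2 | h2
  · rw [max_eq_right h1, max_eq_right (by linarith), max_eq_right (by linarith), sub_zero,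
      ENNReal.ofReal_of_nonpos (by linarith), ENNReal.ofReal_zero]
  · rw [max_eq_right h1, max_eq_left (by linarith), max_eq_right (by linarith), sub_zero]
  · linarith
  · rw [max_eq_left h1, max_eq_left (by linarith), max_eq_left (by linarith)]
    congr 1; ring

/-- The pull-back of the Lebesgue measure along `hinge ξ N` is a combination of restricted
Lebesgue measures. -/
theorem IsPrimeCoding.map_symm_hingeEquiv {ψ : ℝ → ℝ} {ξ : ℕ → ℝ} (h : IsPrimeCoding ψ ξ)
    (N : ℕ) : Measure.map (h.hingeEquiv N).symm volume =
      ENNReal.ofReal (ξ 2) • volume + ∑ j ∈ Finset.Ico 3 N,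
        ENNReal.ofReal (ξ j - ξ (j - 1)) • volume.restrict (Ioi (j : ℝ)) := by
  have hI : ∀ a b, Measure.map (h.hingeEquiv N).symm volume (Ioc a b) =
      ENNReal.ofReal (hinge ξ N b - hinge ξ N a) := by
    intro a b
    rw [MeasurableEquiv.map_apply, ← MeasurableEquiv.image_eq_preimage_symm,
      ← Real.volume_Ioc]
    congr 1
    exact OrderIso.image_Ioc
      ((h.hinge_strictMono N).orderIsoOfSurjective _ (h.hinge_surjective N)) a b
  -- Locally finite measures are compared on half-open intervals, where both sides are the increment
  -- of `hinge ξ N`.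
  refine Measure.ext_of_Ioc' _ _ (fun a b _ => by rw [hI]; exact ENNReal.ofReal_ne_top)
    fun a b hab => ?_
  have hj : ∀ j ∈ Finset.Ico 3 N, 0 < ξ j - ξ (j - 1) := fun j hj =>
    sub_pos.2 (h.coeff_strictMono (by rw [Finset.mem_Ico] at hj; omega))
  have hd : ∀ j : ℕ, 0 ≤ max (b - j) 0 - max (a - j) 0 := fun j =>
    sub_nonneg.2 (max_le_max (by linarith) le_rfl)
  rw [hI, Measure.add_apply, Measure.smul_apply, Measure.finsetSum_apply, Real.volume_Ioc]
  simp only [Measure.smul_apply, smul_eq_mul, Measure.restrict_apply measurableSet_Ioc,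
    volume_Ioc_inter_Ioi _ _ _ hab]
  rw [← ENNReal.ofReal_mul (h.slope_pos 2).le, Finset.sum_congr rfl fun j hj' =>
    (ENNReal.ofReal_mul (hj j hj').le).symm, ← ENNReal.ofReal_sum_of_nonneg fun j hj' =>
      mul_nonneg (hj j hj').le (hd j), ← ENNReal.ofReal_add
      (mul_nonneg (h.slope_pos 2).le (by linarith))
      (Finset.sum_nonneg fun j hj' => mul_nonneg (hj j hj').le (hd j))]
  congr 1
  simp only [hinge, mul_sub, Finset.sum_sub_distrib]
  ring

/-- Beyond `2` the background density `ξ 2` becomes one more half-line term, with `j = 2`; this is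
why `jump ξ 2` is `ξ 2` and not a difference. -/
theorem IsPrimeCoding.map_symm_hingeEquiv_restrict {ψ : ℝ → ℝ} {ξ : ℕ → ℝ}
    (h : IsPrimeCoding ψ ξ) {N : ℕ} (hN : 2 < N) :
    (Measure.map (h.hingeEquiv N).symm volume).restrict (Ioi 2) =
      ∑ j ∈ Finset.Ico 2 N, ENNReal.ofReal (jump ξ j) • volume.restrict (Ioi (j : ℝ)) := by
  rw [h.map_symm_hingeEquiv, Finset.sum_eq_sum_Ico_succ_bot hN, Measure.restrict_add,
    Measure.restrict_smul]
  congr 1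
  rw [← Measure.restrictₗ_apply, map_sum]
  refine Finset.sum_congr rfl fun j hj => ?_
  rw [Finset.mem_Ico] at hj
  have h2 : (2 : ℝ) ≤ j := by exact_mod_cast (by omega : 2 ≤ j)
  rw [Measure.restrictₗ_apply, Measure.restrict_smul, Measure.restrict_restrict measurableSet_Ioi,
    inter_eq_right.2 (Ioi_subset_Ioi h2), jump, if_neg (by omega)]

instance IsPrimeCoding.nullSingletonClass_map_symm_hingeEquiv {ψ : ℝ → ℝ} {ξ : ℕ → ℝ}
    (h : IsPrimeCoding ψ ξ) (N : ℕ) :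
    NullSingletonClass (Measure.map (h.hingeEquiv N).symm (volume : Measure ℝ)) := by
  refine ⟨fun x => ?_⟩
  rw [MeasurableEquiv.map_apply, ← MeasurableEquiv.image_eq_preimage_symm, image_singleton,
    measure_singleton]

/-- On the square `ψ` may be replaced by the global bijection, which turns areas of images into a
product measure of the region itself. -/
theorem IsPrimeCoding.volume_image {ψ : ℝ → ℝ} {ξ : ℕ → ℝ} (h : IsPrimeCoding ψ ξ) {N : ℕ}
    {B : Set (ℝ × ℝ)} (hBN : B ⊆ Ico (2 : ℝ) N ×ˢ Ico (2 : ℝ) N) :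
    volume (Prod.map ψ ψ '' B) = ((Measure.map (h.hingeEquiv N).symm volume).prod
      (Measure.map (h.hingeEquiv N).symm volume)) B := by
  rw [Measure.map_prod_map _ _ (h.hingeEquiv N).symm.measurable (h.hingeEquiv N).symm.measurable,
    ← Measure.volume_eq_prod]
  have e : Prod.map ψ ψ '' B = ((h.hingeEquiv N).prodCongr (h.hingeEquiv N)) '' B :=
    image_congr fun p hp => Prod.ext (h.eq_hinge (hBN hp).1) (h.eq_hinge (hBN hp).2)
  rw [e, MeasurableEquiv.image_eq_preimage_symm, ← MeasurableEquiv.map_apply]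
  rfl

theorem prod_finsetSum_smul_apply {ι : Type*} (s : Finset ι) (c : ι → ENNReal)
    (A : ι → Set ℝ) {B : Set (ℝ × ℝ)} (hB : MeasurableSet B) :
    ((∑ i ∈ s, c i • (volume : Measure ℝ).restrict (A i)).prod
      (∑ i ∈ s, c i • (volume : Measure ℝ).restrict (A i))) B =
      ∑ i ∈ s, ∑ j ∈ s, c i * (c j * volume (B ∩ A i ×ˢ A j)) := by
  rw [← Measure.sum_coe_finset, Measure.prod_sum, Measure.sum_apply _ hB, tsum_fintype,
    Fintype.sum_prod_type, ← Finset.sum_coe_sort s]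
  refine Finset.sum_congr rfl fun i _ => ?_
  rw [← Finset.sum_coe_sort s]
  refine Finset.sum_congr rfl fun j _ => ?_
  rw [Measure.prod_smul_left, Measure.smul_apply, Measure.prod_smul_right, Measure.smul_apply,
    Measure.prod_restrict, Measure.restrict_apply hB, ← Measure.volume_eq_prod, smul_eq_mul,
    smul_eq_mul]

theorem measure_prod_eq_zero_of_subsingleton {μ ν : Measure ℝ} [SFinite ν] [NullSingletonClass ν]
    {B : Set (ℝ × ℝ)} (hB : MeasurableSet B) (hs : ∀ x, (Prod.mk x ⁻¹' B).Subsingleton) :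
    μ.prod ν B = 0 := by
  rw [Measure.measure_prod_null hB]
  exact Filter.Eventually.of_forall fun x => (hs x).measure_zero ν

/-! ### The regions, their symmetry and their complements. -/

theorem measurableSet_lowerRegion (k : ℝ) : MeasurableSet (lowerRegion k) :=
  (measurableSet_le measurable_const measurable_fst).inter
    ((measurableSet_le measurable_fst measurable_snd).inter
      (measurableSet_le (measurable_fst.mul measurable_snd) measurable_const))

theorem measurableSet_upperRegion (α k : ℝ) : MeasurableSet (upperRegion α k) :=
  (measurableSet_le measurable_const measurable_fst).inter
    ((measurableSet_le measurable_fst measurable_snd).inter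
      ((measurableSet_le measurable_const (measurable_fst.mul measurable_snd)).inter
        (measurableSet_le (measurable_fst.mul measurable_snd) measurable_const)))

/-- The region symmetric about the diagonal whose upper half is `lowerRegion k` up to
null sets. -/
def hyperbolicRegion (k : ℝ) : Set (ℝ × ℝ) := {p | 2 < p.1 ∧ 2 < p.2 ∧ p.1 * p.2 ≤ k}

theorem measurableSet_hyperbolicRegion (k : ℝ) : MeasurableSet (hyperbolicRegion k) := by
  unfold hyperbolicRegion
  exact (measurableSet_lt measurable_const measurable_fst).inter
    ((measurableSet_lt measurable_const measurable_snd).inter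
      (measurableSet_le (measurable_fst.mul measurable_snd) measurable_const))

/-- Up to the diagonal and the line `x = 2`, both null, the symmetric region is the disjoint union
of the lower region and its mirror image. The symmetric region imposes no order between the
coordinates, so it can be cut by quadrants. -/
theorem two_mul_measure_lowerRegion (μ : Measure ℝ) [SFinite μ] [NullSingletonClass μ] (k : ℝ) :
    2 * μ.prod μ (lowerRegion k) = μ.prod μ (hyperbolicRegion k) := by
  have hD : μ.prod μ {p | p.1 = p.2} = 0 :=
    measure_prod_eq_zero_of_subsingleton
      (measurableSet_eq_fun measurable_fst measurable_snd) fun x y hy z hz => by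
        simp only [mem_preimage, mem_ofPred_eq] at hy hz; rw [← hy, ← hz]
  have hE : μ.prod μ {p | p.1 = 2} = 0 := by
    have : {p : ℝ × ℝ | p.1 = 2} = {2} ×ˢ univ := by ext; simp
    rw [this, Measure.prod_prod, measure_singleton, zero_mul]
  set L : Set (ℝ × ℝ) := {p | 2 < p.1 ∧ p.1 < p.2 ∧ p.1 * p.2 ≤ k} with hL
  have hLm : MeasurableSet L :=
    (measurableSet_lt measurable_const measurable_fst).inter
    ((measurableSet_lt measurable_fst measurable_snd).inter
      (measurableSet_le (measurable_fst.mul measurable_snd) measurable_const))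
  have e1 : μ.prod μ (lowerRegion k) = μ.prod μ L := by
    refine le_antisymm ?_ (measure_mono fun p hp => ⟨hp.1.le, hp.2.1.le, hp.2.2⟩)
    calc _ ≤ μ.prod μ (L ∪ ({p | p.1 = p.2} ∪ {p | p.1 = 2})) := by
          refine measure_mono fun p ⟨h1, h2, h3⟩ => ?_
          rcases h1.eq_or_lt with h1 | h1
          · exact Or.inr (Or.inr h1.symm)
          rcases h2.eq_or_lt with h2 | h2
          · exact Or.inr (Or.inl h2)
          exact Or.inl ⟨h1, h2, h3⟩
      _ ≤ μ.prod μ L + (μ.prod μ {p | p.1 = p.2} + μ.prod μ {p | p.1 = 2}) :=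
          (measure_union_le _ _).trans (by gcongr; exact measure_union_le _ _)
      _ = _ := by rw [hD, hE, add_zero, add_zero]
  have e2 : μ.prod μ (Prod.swap ⁻¹' L) = μ.prod μ L :=
    (Measure.measurePreserving_swap (μ := μ) (ν := μ)).measure_preimage hLm.nullMeasurableSet
  have hdisj : Disjoint L (Prod.swap ⁻¹' L) := by
    rw [Set.disjoint_left]
    intro p hp hq
    exact lt_asymm hp.2.1 hq.2.1
  rw [e1, two_mul]
  nth_rw 2 [← e2]
  rw [← measure_union hdisj (measurable_swap hLm)]
  refine le_antisymm (measure_mono ?_) ?_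
  · rintro p (⟨h1, h2, h3⟩ | ⟨h1, h2, h3⟩)
    · exact ⟨h1, h1.trans h2, h3⟩
    · exact ⟨h1.trans h2, h1, by rw [mul_comm]; exact h3⟩
  · calc _ ≤ μ.prod μ ((L ∪ Prod.swap ⁻¹' L) ∪ {p | p.1 = p.2}) := by
          refine measure_mono fun p ⟨h1, h2, h3⟩ => ?_
          rcases lt_trichotomy p.1 p.2 with h | h | h
          · exact Or.inl (Or.inl ⟨h1, h, h3⟩)
          · exact Or.inr h
          · exact Or.inl (Or.inr ⟨h2, h, by rw [mul_comm] at h3; exact h3⟩)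
      _ ≤ _ := measure_union_le _ _
      _ = _ := by rw [hD, add_zero]

/-- The two regions meet only on the curve `xy = α - k`, whose vertical slices have at most one
point. -/
theorem measure_upperRegion_add (μ : Measure ℝ) [SFinite μ] [NullSingletonClass μ]
    {α k : ℝ} (hk : 4 ≤ k) :
    μ.prod μ (upperRegion α k) + μ.prod μ (lowerRegion (α - k)) =
      μ.prod μ (lowerRegion (α - 4)) := by
  rw [← measure_union_add_inter _ (measurableSet_lowerRegion _)]
  have h0 : μ.prod μ (upperRegion α k ∩ lowerRegion (α - k)) = 0 := by
    refine measure_prod_eq_zero_of_subsingleton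
      ((measurableSet_upperRegion _ _).inter (measurableSet_lowerRegion _))
      fun x y hy z hz => ?_
    obtain ⟨⟨h1, -, h3, -⟩, -, -, h4⟩ := hy
    obtain ⟨⟨-, -, h5, -⟩, -, -, h6⟩ := hz
    simp only at h1 h3 h4 h5 h6
    exact mul_left_cancel₀ (show x ≠ 0 by linarith)
      ((le_antisymm h4 h3).trans (le_antisymm h6 h5).symm)
  rw [h0, add_zero]
  congr 1
  ext p
  simp only [upperRegion, lowerRegion, mem_union, mem_ofPred_eq]
  constructor
  · rintro (⟨h1, h2, h3, h4⟩ | ⟨h1, h2, h3⟩)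
    · exact ⟨h1, h2, h4⟩
    · exact ⟨h1, h2, by linarith⟩
  · rintro ⟨h1, h2, h3⟩
    rcases le_total (α - k) (p.1 * p.2) with h | h
    · exact Or.inl ⟨h1, h2, h, h3⟩
    · exact Or.inr ⟨h1, h2, h⟩

/-! ### Area under a hyperbola in a quadrant. -/

/-- The area of the region `x ≥ i`, `y ≥ j`, `xy ≤ k` as a function of `k` and `m = ij`. -/
noncomputable def cornerArea (m k : ℝ) : ℝ :=
  if m ≤ k then k * Real.log (k / m) - k + m else 0

theorem cornerArea_nonneg {m : ℝ} (hm : 0 < m) (k : ℝ) : 0 ≤ cornerArea m k := by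
  unfold cornerArea
  split_ifs with h
  · have hk : 0 < k := hm.trans_le h
    have h1 := Real.one_sub_inv_le_log_of_pos (div_pos hk hm)
    have h2 := mul_le_mul_of_nonneg_left h1 hk.le
    have h3 : k * (1 - (k / m)⁻¹) = k - m := by field_simp
    linarith
  · exact le_rfl

theorem volume_hyperbolicRegion_inter {i j : ℝ} (hi : 2 ≤ i) (hj : 2 ≤ j) (k : ℝ) :
    volume (hyperbolicRegion k ∩ Ioi i ×ˢ Ioi j) = ENNReal.ofReal (cornerArea (i * j) k) := by
  have hi0 : 0 < i := by linarith
  have hj0 : 0 < j := by linarith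
  have hsl : ∀ x, Prod.mk x ⁻¹' (hyperbolicRegion k ∩ Ioi i ×ˢ Ioi j) =
      if i < x then Ioc j (k / x) else ∅ := by
    intro x
    ext y
    split_ifs with hx
    · simp only [hyperbolicRegion, mem_preimage, mem_inter_iff, mem_ofPred_eq, mem_prod, mem_Ioi,
        mem_Ioc, le_div_iff₀' (hi0.trans hx)]
      constructor
      · rintro ⟨⟨-, -, h⟩, -, h'⟩; exact ⟨h', h⟩
      · rintro ⟨h', h⟩; exact ⟨⟨by linarith, by linarith, h⟩, hx, h'⟩
    · simp [hx]
  rw [Measure.volume_eq_prod, Measure.prod_apply ((measurableSet_hyperbolicRegion k).inter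
    (measurableSet_Ioi.prod measurableSet_Ioi))]
  -- The slice at `x > i` is `(j, k/x]`, which is empty once `x > k/j`; the area is the integral of
  -- `k/x - j` over `(i, k/j]`.
  have hfun : (fun x => volume (Prod.mk x ⁻¹' (hyperbolicRegion k ∩ Ioi i ×ˢ Ioi j))) =
      (Ioc i (k / j)).indicator fun x => ENNReal.ofReal (k / x - j) := by
    ext x
    rw [hsl]
    by_cases hx : i < x
    · rw [if_pos hx, Real.volume_Ioc]
      by_cases hx2 : x ≤ k / j
      · rw [indicator_of_mem (show x ∈ Ioc i (k / j) from ⟨hx, hx2⟩)]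
      · rw [indicator_of_notMem (fun h => hx2 h.2)]
        rw [ENNReal.ofReal_of_nonpos]
        have hx0 : 0 < x := hi0.trans hx
        rw [sub_nonpos, div_le_iff₀ hx0]
        rw [not_le, div_lt_iff₀ hj0] at hx2
        linarith
    · rw [if_neg hx, measure_empty, indicator_of_notMem (fun h => hx h.1)]
  rw [hfun, lintegral_indicator measurableSet_Ioc]
  unfold cornerArea
  split_ifs with hk
  · have hle : i ≤ k / j := by rwa [le_div_iff₀ hj0]
    have h0 : (0 : ℝ) ∉ uIcc i (k / j) := by
      rw [uIcc_of_le hle]; exact fun h => absurd h.1 (by linarith)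
    have hint : IntervalIntegrable (fun x : ℝ => k / x - j) volume i (k / j) := by
      refine ContinuousOn.intervalIntegrable fun x hx => ?_
      have : x ≠ 0 := fun h => h0 (h ▸ hx)
      fun_prop (disch := assumption)
    rw [← ofReal_integral_eq_lintegral_ofReal
      ((intervalIntegrable_iff_integrableOn_Ioc_of_le hle).1 hint),
      ← intervalIntegral.integral_of_le hle]
    · congr 1
      have hint' : IntervalIntegrable (fun x : ℝ => k * x⁻¹) volume i (k / j) := by
        refine ContinuousOn.intervalIntegrable fun x hx => ?_
        have : x ≠ 0 := fun h => h0 (h ▸ hx)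
        fun_prop (disch := assumption)
      simp only [div_eq_mul_inv k (_ : ℝ)] at hint h0 ⊢
      rw [intervalIntegral.integral_sub (by simpa [div_eq_mul_inv] using hint')
        intervalIntegrable_const, intervalIntegral.integral_const_mul, integral_inv h0,
        intervalIntegral.integral_const]
      have : k * j⁻¹ / i = k * (i * j)⁻¹ := by field_simp
      rw [this, smul_eq_mul]
      field_simp
      ring
    · refine (ae_restrict_iff' measurableSet_Ioc).2 (Filter.Eventually.of_forall fun x hx => ?_)
      have hx0 : 0 < x := hi0.trans hx.1
      have := hx.2
      rw [le_div_iff₀ hj0] at this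
      simp only [Pi.zero_apply, sub_nonneg]
      rw [le_div_iff₀ hx0]
      linarith
  · rw [Ioc_eq_empty, Measure.restrict_empty, lintegral_zero_measure, ENNReal.ofReal_zero]
    rw [not_lt, div_le_iff₀ hj0]
    linarith

/-! ### Explicit area functions and essential polynomials. -/

/-- The area of the image of `lowerRegion k` as an explicit function of `k`. -/
noncomputable def areaSum (ξ : ℕ → ℝ) (N : ℕ) (k : ℝ) : ℝ :=
  1 / 2 * ∑ i ∈ Finset.Ico 2 N, ∑ j ∈ Finset.Ico 2 N,
    jump ξ i * jump ξ j * cornerArea (i * j) k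

/-- The derivative of `cornerArea m`. -/
noncomputable def cornerSlope (m k : ℝ) : ℝ := if m ≤ k then Real.log (k / m) else 0

/-- The derivative of `areaSum ξ N`. -/
noncomputable def slopeSum (ξ : ℕ → ℝ) (N : ℕ) (k : ℝ) : ℝ :=
  1 / 2 * ∑ i ∈ Finset.Ico 2 N, ∑ j ∈ Finset.Ico 2 N,
    jump ξ i * jump ξ j * cornerSlope (i * j) k

/-- The value at `ξ` of the lower essential polynomial of `n`. -/
noncomputable def essentialValue (ξ : ℕ → ℝ) (N n : ℕ) : ℝ :=
  1 / 2 * ∑ i ∈ Finset.Ico 2 N, ∑ j ∈ Finset.Ico 2 N,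
    jump ξ i * jump ξ j * if i * j ≤ n then 1 else 0

/-- The lower essential polynomial of `n`, for `n < N`. -/
noncomputable def essentialPolynomial (N n : ℕ) : MvPolynomial ℕ ℝ :=
  MvPolynomial.C (1 / 2) * ∑ i ∈ Finset.Ico 2 N, ∑ j ∈ Finset.Ico 2 N,
    jump MvPolynomial.X i * jump MvPolynomial.X j * if i * j ≤ n then 1 else 0

theorem eval_jump (ξ : ℕ → ℝ) (j : ℕ) :
    MvPolynomial.eval ξ (jump MvPolynomial.X j) = jump ξ j := by
  unfold jump
  split_ifs <;> simp

theorem eval_essentialPolynomial (ξ : ℕ → ℝ) (N n : ℕ) :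
    MvPolynomial.eval ξ (essentialPolynomial N n) = essentialValue ξ N n := by
  simp only [essentialPolynomial, essentialValue, map_mul, map_sum, MvPolynomial.eval_C, eval_jump,
    apply_ite (MvPolynomial.eval ξ), map_one, map_zero]

/-- From `x ≥ 2` and `xy ≤ k < 2N` it follows that `y < N`, so the region stays where `hinge ξ N`
agrees with `ψ`. -/
theorem subset_of_mem_lowerRegion {N : ℕ} {k : ℝ} (hk : k < 2 * N) :
    lowerRegion k ⊆ Ico (2 : ℝ) N ×ˢ Ico (2 : ℝ) N := by
  rintro ⟨x, y⟩ ⟨h1, h2, h3⟩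
  simp only at h1 h2 h3
  have : y < N := by nlinarith
  exact ⟨⟨h1, h2.trans_lt this⟩, h1.trans h2, this⟩

theorem IsPrimeCoding.areaSum_nonneg {ψ : ℝ → ℝ} {ξ : ℕ → ℝ} (h : IsPrimeCoding ψ ξ) (N : ℕ)
    (k : ℝ) : 0 ≤ areaSum ξ N k := by
  refine mul_nonneg (by norm_num) (Finset.sum_nonneg fun i hi => Finset.sum_nonneg fun j hj => ?_)
  rw [Finset.mem_Ico] at hi hj
  have : (0 : ℝ) < i := by exact_mod_cast (by omega : 0 < i)
  have : (0 : ℝ) < j := by exact_mod_cast (by omega : 0 < j)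
  exact mul_nonneg (mul_pos (h.jump_pos hi.1) (h.jump_pos hj.1)).le
    (cornerArea_nonneg (by positivity) k)

theorem IsPrimeCoding.volume_image_lowerRegion {ψ : ℝ → ℝ} {ξ : ℕ → ℝ} (h : IsPrimeCoding ψ ξ)
    {N : ℕ} (hN : 2 < N) {k : ℝ} (hk : k < 2 * N) :
    volume (Prod.map ψ ψ '' lowerRegion k) = ENNReal.ofReal (areaSum ξ N k) := by
  have hsub : hyperbolicRegion k ⊆ Ioi 2 ×ˢ Ioi 2 := fun p hp => ⟨hp.1, hp.2.1⟩
  have h2 : 2 * volume (Prod.map ψ ψ '' lowerRegion k) =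
      2 * ENNReal.ofReal (areaSum ξ N k) := by
    rw [h.volume_image (subset_of_mem_lowerRegion hk), two_mul_measure_lowerRegion,
      ← Measure.restrict_eq_self _ hsub, ← Measure.prod_restrict,
      h.map_symm_hingeEquiv_restrict hN,
      prod_finsetSum_smul_apply _ _ _ (measurableSet_hyperbolicRegion k)]
    have hterm : ∀ i ∈ Finset.Ico 2 N, ∀ j ∈ Finset.Ico 2 N,
        0 ≤ jump ξ i * jump ξ j * cornerArea (i * j) k := by
      intro i hi j hj
      rw [Finset.mem_Ico] at hi hj
      have : (0 : ℝ) < i := by exact_mod_cast (by omega : 0 < i)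
      have : (0 : ℝ) < j := by exact_mod_cast (by omega : 0 < j)
      exact mul_nonneg (mul_pos (h.jump_pos hi.1) (h.jump_pos hj.1)).le
        (cornerArea_nonneg (by positivity) k)
    rw [show (2 : ENNReal) = ENNReal.ofReal 2 by simp, ← ENNReal.ofReal_mul (by norm_num),
      areaSum, ← mul_assoc, show (2 : ℝ) * (1 / 2) = 1 by norm_num, one_mul,
      ENNReal.ofReal_sum_of_nonneg fun i hi => Finset.sum_nonneg fun j hj => hterm i hi j hj]
    refine Finset.sum_congr rfl fun i hi => ?_
    rw [ENNReal.ofReal_sum_of_nonneg fun j hj => hterm i hi j hj]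
    refine Finset.sum_congr rfl fun j hj => ?_
    rw [Finset.mem_Ico] at hi hj
    rw [volume_hyperbolicRegion_inter (by exact_mod_cast hi.1) (by exact_mod_cast hj.1),
      mul_assoc (jump ξ i), ENNReal.ofReal_mul (h.jump_pos hi.1).le,
      ENNReal.ofReal_mul (h.jump_pos hj.1).le]
  exact (ENNReal.mul_right_inj (by norm_num) (by norm_num)).1 h2

theorem IsPrimeCoding.lowerArea_map {ψ : ℝ → ℝ} {ξ : ℕ → ℝ} (h : IsPrimeCoding ψ ξ)
    {N : ℕ} (hN : 2 < N) {k : ℝ} (hk0 : 0 ≤ k) (hk : k < 2 * N) :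
    lowerArea ψ (ψ k) = areaSum ξ N k := by
  rw [lowerArea, h.inv_map hk0, h.volume_image_lowerRegion hN hk,
    ENNReal.toReal_ofReal (h.areaSum_nonneg N k)]

theorem IsPrimeCoding.upperArea_map {ψ : ℝ → ℝ} {ξ : ℕ → ℝ} (h : IsPrimeCoding ψ ξ)
    {N : ℕ} (hN : 2 < N) {k : ℝ} (hk : 4 ≤ k) :
    upperArea ψ N (ψ k) = areaSum ξ N (N - 4) - areaSum ξ N (N - k) := by
  have hN0 : (0 : ℝ) < N := by exact_mod_cast (by omega : 0 < N)
  have hsub : upperRegion N k ⊆ lowerRegion (N - 4) := fun p hp => ⟨hp.1, hp.2.1, hp.2.2.2⟩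
  have hb : ∀ t : ℝ, 4 ≤ t → lowerRegion (N - t) ⊆ Ico (2 : ℝ) N ×ˢ Ico (2 : ℝ) N :=
    fun t ht => subset_of_mem_lowerRegion (by linarith)
  have e := measure_upperRegion_add (Measure.map (h.hingeEquiv N).symm volume) (α := N) hk
  rw [← h.volume_image (hb k hk), ← h.volume_image (hb 4 le_rfl),
    ← h.volume_image (hsub.trans (hb 4 le_rfl)),
    h.volume_image_lowerRegion hN (by linarith), h.volume_image_lowerRegion hN (by linarith)] at e
  -- Finiteness has to be known before passing to real numbers, since `toReal` sends `⊤` to `0`.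
  have hfin : volume (Prod.map ψ ψ '' upperRegion N k) ≠ ⊤ := fun ht => by
    rw [ht, top_add] at e
    exact ENNReal.ofReal_ne_top e.symm
  have e' := congrArg ENNReal.toReal e
  rw [ENNReal.toReal_add hfin ENNReal.ofReal_ne_top, ENNReal.toReal_ofReal (h.areaSum_nonneg _ _),
    ENNReal.toReal_ofReal (h.areaSum_nonneg _ _)] at e'
  rw [upperArea, h.inv_map (by linarith)]
  linarith

/-! ### Derivatives in `k`, then in `ψ(k)`. -/

/-- The breakpoint `m` is an integer, so it is never interior to `[n, n+1]` and a single formula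
holds on the whole interval. If `m = n + 1`, it is met only at the right end, where the value `k
log(k/m) - k + m` and the slope `log(k/m)` are both `0`. -/
theorem hasDerivWithinAt_cornerArea {m n : ℕ} (hm : 0 < m) {k : ℝ}
    (hk : k ∈ Icc (n : ℝ) (n + 1)) :
    HasDerivWithinAt (cornerArea m) (cornerSlope m k) (Icc (n : ℝ) (n + 1)) k := by
  have hm0 : (0 : ℝ) < m := by exact_mod_cast hm
  rcases le_or_gt m n with hmn | hmn
  · have hmn' : (m : ℝ) ≤ n := by exact_mod_cast hmn
    have hkm : (m : ℝ) ≤ k := hmn'.trans hk.1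
    have hk0 : 0 < k := hm0.trans_le hkm
    have h1 : HasDerivAt (fun k : ℝ => k * Real.log (k / m) - k + m) (Real.log (k / m)) k := by
      have h2 := ((hasDerivAt_id k).div_const (m : ℝ)).log (div_pos hk0 hm0).ne'
      have h3 := (((hasDerivAt_id k).mul h2).sub (hasDerivAt_id k)).add_const (m : ℝ)
      refine h3.congr_deriv ?_
      simp only [id]
      field_simp
      ring
    rw [cornerSlope, if_pos hkm]
    exact h1.hasDerivWithinAt.congr (fun x hx => if_pos (hmn'.trans hx.1)) (if_pos hkm)
  · have hmn' : (n : ℝ) + 1 ≤ m := by exact_mod_cast hmn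
    have hz : ∀ x ∈ Icc (n : ℝ) (n + 1), cornerArea m x = 0 ∧ cornerSlope m x = 0 := by
      intro x hx
      unfold cornerArea cornerSlope
      split_ifs with h
      · have : x = m := le_antisymm (hx.2.trans hmn') h
        rw [this, div_self hm0.ne']
        simp
      · simp
    rw [(hz k hk).2]
    exact (hasDerivWithinAt_const k _ (0 : ℝ)).congr (fun x hx => (hz x hx).1) (hz k hk).1

theorem hasDerivWithinAt_cornerSlope {m n : ℕ} (hm : 0 < m) {k : ℝ}
    (hk : k ∈ Icc (n : ℝ) (n + 1)) :
    HasDerivWithinAt (cornerSlope m) ((if m ≤ n then 1 else 0) * (1 / k))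
      (Icc (n : ℝ) (n + 1)) k := by
  have hm0 : (0 : ℝ) < m := by exact_mod_cast hm
  split_ifs with hmn
  · have hmn' : (m : ℝ) ≤ n := by exact_mod_cast hmn
    have hkm : (m : ℝ) ≤ k := hmn'.trans hk.1
    have hk0 : 0 < k := hm0.trans_le hkm
    have h1 : HasDerivAt (fun k : ℝ => Real.log (k / m)) (1 * (1 / k)) k := by
      refine (((hasDerivAt_id k).div_const (m : ℝ)).log (div_pos hk0 hm0).ne').congr_deriv ?_
      simp only [id]
      field_simp
    exact h1.hasDerivWithinAt.congr (fun x hx => if_pos (hmn'.trans hx.1)) (if_pos hkm)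
  · have hmn' : (n : ℝ) + 1 ≤ m := by exact_mod_cast not_le.1 hmn
    have hz : ∀ x ∈ Icc (n : ℝ) (n + 1), cornerSlope m x = 0 := by
      intro x hx
      unfold cornerSlope
      split_ifs with h
      · have : x = m := le_antisymm (hx.2.trans hmn') h
        rw [this, div_self hm0.ne', Real.log_one]
      · rfl
    rw [zero_mul]
    exact (hasDerivWithinAt_const k _ (0 : ℝ)).congr hz (hz k hk)

theorem hasDerivWithinAt_areaSum (ξ : ℕ → ℝ) (N : ℕ) {n : ℕ} {k : ℝ}
    (hk : k ∈ Icc (n : ℝ) (n + 1)) :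
    HasDerivWithinAt (areaSum ξ N) (slopeSum ξ N k) (Icc (n : ℝ) (n + 1)) k := by
  unfold areaSum slopeSum
  refine HasDerivWithinAt.const_mul _ (HasDerivWithinAt.fun_sum fun i hi =>
    HasDerivWithinAt.fun_sum fun j hj => HasDerivWithinAt.const_mul _ ?_)
  rw [Finset.mem_Ico] at hi hj
  exact_mod_cast hasDerivWithinAt_cornerArea (Nat.mul_pos (by omega) (by omega) : 0 < i * j) hk

theorem hasDerivWithinAt_slopeSum (ξ : ℕ → ℝ) (N : ℕ) {n : ℕ} {k : ℝ}
    (hk : k ∈ Icc (n : ℝ) (n + 1)) :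
    HasDerivWithinAt (slopeSum ξ N) (essentialValue ξ N n * (1 / k)) (Icc (n : ℝ) (n + 1)) k := by
  unfold slopeSum essentialValue
  rw [mul_assoc, Finset.sum_mul]
  simp_rw [Finset.sum_mul]
  refine HasDerivWithinAt.const_mul _ (HasDerivWithinAt.fun_sum fun i hi =>
    HasDerivWithinAt.fun_sum fun j hj => ?_)
  rw [mul_assoc]
  refine HasDerivWithinAt.const_mul _ ?_
  rw [Finset.mem_Ico] at hi hj
  exact_mod_cast hasDerivWithinAt_cornerSlope (Nat.mul_pos (by omega) (by omega) : 0 < i * j) hk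

/-- Differentiation in the variable `u = ψ(k)`. -/
theorem IsPrimeCoding.hasSecondDerivOn {ψ : ℝ → ℝ} {ξ : ℕ → ℝ} (h : IsPrimeCoding ψ ξ) (n : ℕ)
    {f G G' G'' : ℝ → ℝ} (hf : ∀ k ∈ Icc (n : ℝ) (n + 1), f (ψ k) = G k)
    (hG : ∀ k ∈ Icc (n : ℝ) (n + 1), HasDerivWithinAt G (G' k) (Icc (n : ℝ) (n + 1)) k)
    (hG' : ∀ k ∈ Icc (n : ℝ) (n + 1), HasDerivWithinAt G' (G'' k) (Icc (n : ℝ) (n + 1)) k) :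
    HasSecondDerivOn f (fun u => G'' (inv ψ u) / ξ n ^ 2) (Icc (ψ n) (ψ (n + 1))) := by
  have hξ := h.slope_pos n
  have hn0 : (0 : ℝ) ≤ n := n.cast_nonneg
  -- The affine inverse of `ψ` on this interval; its slope `1 / ξ n` enters once per
  -- differentiation.
  set L : ℝ → ℝ := fun u => n + (u - ψ n) / ξ n with hL
  have e1 : ψ (n + 1) = ψ n + ξ n := by
    have := h.map_natCast (n + 1)
    push_cast at this
    rw [this, Finset.sum_range_succ, ← h.map_natCast]
  have hmaps : MapsTo L (Icc (ψ n) (ψ (n + 1))) (Icc (n : ℝ) (n + 1)) := by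
    intro u hu
    rw [e1] at hu
    have h1 : 0 ≤ (u - ψ n) / ξ n := div_nonneg (by linarith [hu.1]) hξ.le
    have h2 : (u - ψ n) / ξ n ≤ 1 := (div_le_one hξ).2 (by linarith [hu.2])
    exact ⟨by simp only [hL]; linarith, by simp only [hL]; linarith⟩
  have hψL : ∀ u ∈ Icc (ψ n) (ψ (n + 1)), ψ (L u) = u := by
    intro u hu
    rw [h.affine n _ (hmaps hu), ← h.map_natCast]
    simp only [hL]
    field_simp
    ring
  have hinv : ∀ u ∈ Icc (ψ n) (ψ (n + 1)), inv ψ u = L u := by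
    intro u hu
    conv_lhs => rw [← hψL u hu]
    exact h.inv_map (hn0.trans (hmaps hu).1)
  have hLd : ∀ u, HasDerivWithinAt L (1 / ξ n) (Icc (ψ n) (ψ (n + 1))) u := fun u =>
    ((((hasDerivAt_id u).sub_const (ψ n)).div_const (ξ n)).const_add (n : ℝ)).hasDerivWithinAt
  refine ⟨fun u => G' (L u) * (1 / ξ n), fun u hu => ?_, fun u hu => ?_⟩
  · have hc : ∀ v ∈ Icc (ψ n) (ψ (n + 1)), f v = (G ∘ L) v := fun v hv => by
      rw [Function.comp, ← hf _ (hmaps hv), hψL v hv]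
    exact ((hG _ (hmaps hu)).comp u (hLd u) hmaps).congr hc (hc u hu)
  · refine (((hG' _ (hmaps hu)).comp u (hLd u) hmaps).mul_const (1 / ξ n)).congr_deriv ?_
    simp only [hinv u hu]
    field_simp

/-! ### Existence and uniqueness of the essential points. -/

theorem isLowerEssentialPolynomial {N n : ℕ} (hN : 2 < N) (hn : n < N) :
    IsLowerEssentialPolynomial n (essentialPolynomial N n) := by
  intro ψ ξ h
  have hnN : (n : ℝ) + 1 ≤ N := by exact_mod_cast hn
  have hn0 : (0 : ℝ) ≤ n := n.cast_nonneg
  have := h.hasSecondDerivOn n (f := lowerArea ψ) (G := areaSum ξ N) (G' := slopeSum ξ N)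
    (G'' := fun k => essentialValue ξ N n * (1 / k))
    (fun k hk => h.lowerArea_map hN (hn0.trans hk.1) (by linarith [hk.2]))
    (fun k hk => hasDerivWithinAt_areaSum ξ N hk) (fun k hk => hasDerivWithinAt_slopeSum ξ N hk)
  convert this using 2 with u
  rw [eval_essentialPolynomial]
  have := h.slope_pos n
  field_simp

/-- The reflection `k ↦ N - k` carries `[n, n+1]` onto `[N-n-1, N-n]`, hence the index `N - n - 1`.
In a constant minus `A(N - k)` the first derivative is `A'(N - k)` and the second is `-A''(N - k)`,
hence the sign. -/
theorem isUpperEssentialPolynomial {N n : ℕ} (hn4 : 4 ≤ n) (hn : n < N) :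
    IsUpperEssentialPolynomial N n (-essentialPolynomial N (N - n - 1)) := by
  intro ψ ξ h
  have hn4' : (4 : ℝ) ≤ n := by exact_mod_cast hn4
  have hcast : ((N - n - 1 : ℕ) : ℝ) = N - n - 1 := by
    rw [Nat.sub_sub, Nat.cast_sub hn]; push_cast; ring
  have hmaps : MapsTo (fun k : ℝ => N - k) (Icc (n : ℝ) (n + 1))
      (Icc ((N - n - 1 : ℕ) : ℝ) ((N - n - 1 : ℕ) + 1)) := fun k hk => by
    rw [hcast]
    exact ⟨by linarith [hk.2], by linarith [hk.1]⟩
  have hd : ∀ k, HasDerivWithinAt (fun k : ℝ => N - k) (-1) (Icc (n : ℝ) (n + 1)) k := fun k =>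
    ((hasDerivAt_id k).const_sub (N : ℝ)).hasDerivWithinAt
  have := h.hasSecondDerivOn n (f := upperArea ψ N)
    (G := fun k => areaSum ξ N (N - 4) - areaSum ξ N (N - k)) (G' := fun k => slopeSum ξ N (N - k))
    (G'' := fun k => -(essentialValue ξ N (N - n - 1) * (1 / (N - k))))
    (fun k hk => h.upperArea_map (by omega) (hn4'.trans hk.1))
    (fun k hk => (((hasDerivWithinAt_areaSum ξ N (hmaps hk)).comp k (hd k) hmaps).const_sub
      _).congr_deriv (by ring))
    (fun k hk => ((hasDerivWithinAt_slopeSum ξ N (hmaps hk)).comp k (hd k) hmaps).congr_deriv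
      (by ring))
  convert this using 2 with u
  rw [map_neg, eval_essentialPolynomial, ← one_div_mul_one_div]
  ring

theorem HasSecondDerivOn.unique {f g₁ g₂ : ℝ → ℝ} {s : Set ℝ} (hs : UniqueDiffOn ℝ s)
    (h₁ : HasSecondDerivOn f g₁ s) (h₂ : HasSecondDerivOn f g₂ s) : EqOn g₁ g₂ s := by
  obtain ⟨f₁, h1, h1'⟩ := h₁
  obtain ⟨f₂, h2, h2'⟩ := h₂
  have he : EqOn f₁ f₂ s := fun u hu => (hs u hu).eq_deriv _ (h1 u hu) (h2 u hu)
  exact fun u hu => (hs u hu).eq_deriv _ (h1' u hu) ((h2' u hu).congr he (he hu))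

/-- Second derivatives on a nondegenerate interval are unique; at the left end `k = n` the factor `1
/ (ξ_n² n)` is nonzero and cancels. Only values at `ξ` are compared, which is all an essential point
depends on. -/
theorem IsPrimeCoding.eval_eq_of_isLowerEssentialPolynomial {ψ : ℝ → ℝ} {ξ : ℕ → ℝ}
    (h : IsPrimeCoding ψ ξ) {n : ℕ} (hn : 0 < n) {p q : MvPolynomial ℕ ℝ}
    (hp : IsLowerEssentialPolynomial n p) (hq : IsLowerEssentialPolynomial n q) :
    MvPolynomial.eval ξ p = MvPolynomial.eval ξ q := by
  have hn0 : (0 : ℝ) < n := by exact_mod_cast hn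
  have hlt : ψ n < ψ (n + 1) :=
    h.strictMonoOn hn0.le (show (0 : ℝ) ≤ n + 1 by linarith) (by linarith)
  have e := (hp ψ ξ h).unique (uniqueDiffOn_Icc hlt) (hq ψ ξ h) (left_mem_Icc.2 hlt.le)
  simp only [h.inv_map hn0.le] at e
  have := h.slope_pos n
  exact mul_right_cancel₀ (by positivity) e

theorem IsPrimeCoding.eval_eq_of_isUpperEssentialPolynomial {ψ : ℝ → ℝ} {ξ : ℕ → ℝ}
    (h : IsPrimeCoding ψ ξ) {α n : ℕ} (hn : n < α) {p q : MvPolynomial ℕ ℝ}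
    (hp : IsUpperEssentialPolynomial α n p) (hq : IsUpperEssentialPolynomial α n q) :
    MvPolynomial.eval ξ p = MvPolynomial.eval ξ q := by
  have hn0 : (0 : ℝ) ≤ n := n.cast_nonneg
  have hlt : ψ n < ψ (n + 1) :=
    h.strictMonoOn hn0 (show (0 : ℝ) ≤ n + 1 by linarith) (by linarith)
  have e := (hp ψ ξ h).unique (uniqueDiffOn_Icc hlt) (hq ψ ξ h) (left_mem_Icc.2 hlt.le)
  simp only [h.inv_map hn0] at e
  have := h.slope_pos n
  have : (0 : ℝ) < α - n := sub_pos.2 (by exact_mod_cast hn)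
  exact mul_right_cancel₀ (by positivity) e

theorem IsPrimeCoding.isEssentialPoint_iff {ψ : ℝ → ℝ} {ξ : ℕ → ℝ} (h : IsPrimeCoding ψ ξ)
    {α n : ℕ} (hn4 : 4 ≤ n) (hn : n < α) (Q : ℝ × ℝ) :
    IsEssentialPoint α ξ n Q ↔
      Q = (essentialValue ξ α n, -essentialValue ξ α (α - n - 1)) := by
  have hl : IsLowerEssentialPolynomial n (essentialPolynomial α n) :=
    isLowerEssentialPolynomial (by omega) hn
  have hu := isUpperEssentialPolynomial hn4 hn
  constructor
  · rintro ⟨p, q, hp, hq, rfl⟩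
    rw [h.eval_eq_of_isLowerEssentialPolynomial (by omega) hp hl,
      h.eval_eq_of_isUpperEssentialPolynomial hn hq hu, map_neg, eval_essentialPolynomial,
      eval_essentialPolynomial]
  · rintro rfl
    exact ⟨_, _, hl, hu, by rw [map_neg, eval_essentialPolynomial, eval_essentialPolynomial]⟩

/-! ### Primality from the essential values. -/

/-- The lower essential value is unchanged from `n` to `n + 1` exactly when `n + 1` is prime. -/
theorem IsPrimeCoding.essentialValue_eq_iff_prime {ψ : ℝ → ℝ} {ξ : ℕ → ℝ} (h : IsPrimeCoding ψ ξ)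
    {N n : ℕ} (hn : 1 ≤ n) (hnN : n < N) :
    essentialValue ξ N n = essentialValue ξ N (n + 1) ↔ Nat.Prime (n + 1) := by
  have hpos : ∀ i ∈ Finset.Ico 2 N, ∀ j ∈ Finset.Ico 2 N, 0 < jump ξ i * jump ξ j :=
    fun i hi j hj => mul_pos (h.jump_pos (Finset.mem_Ico.1 hi).1)
      (h.jump_pos (Finset.mem_Ico.1 hj).1)
  have hdiff : essentialValue ξ N (n + 1) - essentialValue ξ N n =
      1 / 2 * ∑ i ∈ Finset.Ico 2 N, ∑ j ∈ Finset.Ico 2 N,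
        jump ξ i * jump ξ j * if i * j = n + 1 then 1 else 0 := by
    simp only [essentialValue, ← mul_sub, ← Finset.sum_sub_distrib]
    congr 1
    refine Finset.sum_congr rfl fun i _ => Finset.sum_congr rfl fun j _ => ?_
    congr 1
    rcases lt_trichotomy (i * j) (n + 1) with hlt | heq | hgt
    · rw [if_pos (by omega), if_pos (by omega), if_neg (by omega), sub_self]
    · rw [if_pos (by omega), if_neg (by omega), if_pos heq, sub_zero]
    · rw [if_neg (by omega), if_neg (by omega), if_neg (by omega), sub_self]
  have hnn : ∀ i ∈ Finset.Ico 2 N, ∀ j ∈ Finset.Ico 2 N,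
      0 ≤ jump ξ i * jump ξ j * if i * j = n + 1 then (1 : ℝ) else 0 := fun i hi j hj =>
    mul_nonneg (hpos i hi j hj).le (by split_ifs <;> norm_num)
  -- A sum of nonnegative terms vanishes only if each term does; positivity of the jumps then
  -- excludes every factorisation `i * j = n + 1`.
  rw [eq_comm, ← sub_eq_zero, hdiff, mul_eq_zero, or_iff_right (by norm_num),
    Finset.sum_eq_zero_iff_of_nonneg fun i hi => Finset.sum_nonneg (hnn i hi)]
  have hi' : (∀ i ∈ Finset.Ico 2 N, ∑ j ∈ Finset.Ico 2 N,
      (jump ξ i * jump ξ j * if i * j = n + 1 then (1 : ℝ) else 0) = 0) ↔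
      ∀ i ∈ Finset.Ico 2 N, ∀ j ∈ Finset.Ico 2 N, i * j ≠ n + 1 := by
    refine forall₂_congr fun i hi => ?_
    rw [Finset.sum_eq_zero_iff_of_nonneg (hnn i hi)]
    refine forall₂_congr fun j hj => ?_
    rw [mul_eq_zero, or_iff_right (hpos i hi j hj).ne']
    simp
  rw [hi']
  constructor
  · intro hne
    by_contra hp
    -- Both factors are proper divisors of `n + 1 ≤ N`, so they lie in the summation range.
    obtain ⟨a, b, ha, hb, hab⟩ := (Nat.not_prime_iff_exists_mul_eq (by omega)).1 hp
    have ha2 : 2 ≤ a := by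
      by_contra hlt
      have : a = 0 ∨ a = 1 := by omega
      rcases this with rfl | rfl <;> omega
    have hb2 : 2 ≤ b := by
      by_contra hlt
      have : b = 0 ∨ b = 1 := by omega
      rcases this with rfl | rfl <;> omega
    exact hne a (Finset.mem_Ico.2 ⟨ha2, by omega⟩) b (Finset.mem_Ico.2 ⟨hb2, by omega⟩) hab
  · intro hp i hi j hj hij
    rw [Finset.mem_Ico] at hi hj
    rw [← hij] at hp
    exact Nat.not_prime_mul (by omega) (by omega) hp

end GoldbachEssential

theorem corollary2p8p3 (α : ℕ) (hα : Even α) (hα16 : 16 ≤ α) (ψ : ℝ → ℝ) (ξ : ℕ → ℝ)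
    (hψ : GoldbachEssential.IsPrimeCoding ψ ξ) :
    ∃ P : ℕ → ℝ × ℝ,
      (∀ k₀ ∈ Finset.Icc 4 (α / 2 - 1), ∀ Q : ℝ × ℝ,
        GoldbachEssential.IsEssentialPoint α ξ k₀ Q ↔ Q = P k₀) ∧
      ∀ k₀ ∈ Finset.Icc 5 (α / 2 - 1),
        ((Nat.Prime k₀ ∧ Nat.Prime (α - k₀) ∧ α = k₀ + (α - k₀)) ↔ P (k₀ - 1) = P k₀) := by
  refine ⟨fun n => (GoldbachEssential.essentialValue ξ α n,
    -GoldbachEssential.essentialValue ξ α (α - n - 1)), fun k hk Q => ?_, fun k hk => ?_⟩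
  · rw [Finset.mem_Icc] at hk
    exact hψ.isEssentialPoint_iff hk.1 (by omega) Q
  · rw [Finset.mem_Icc] at hk
    -- The abscissas compare indices `k - 1` and `k`; the ordinates compare `α - k` and `α - k - 1`,
    -- in reversed order.
    have h1 := hψ.essentialValue_eq_iff_prime (N := α) (n := k - 1) (by omega) (by omega)
    have h2 := hψ.essentialValue_eq_iff_prime (N := α) (n := α - k - 1) (by omega) (by omega)
    rw [show k - 1 + 1 = k by omega] at h1
    rw [show α - k - 1 + 1 = α - k by omega] at h2
    rw [Prod.mk.injEq, neg_inj, h1, show α - (k - 1) - 1 = α - k by omega, eq_comm (a :=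
      GoldbachEssential.essentialValue ξ α (α - k)), h2]
    exact and_congr_right fun _ => and_iff_left (by omega)
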